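/- Lemma (Analytic bases). Let $U\subset\mathbb{C}$ be open and consider the linear equation $u_x=A(x;\lambda)u$, $x\in\mathbb{R}$, $u\in\mathbb{C}^N$, where $A(x;\lambda)\in\mathbb{C}^{N\times N}$ is continuous in $x$, analytic in $\lambda\in U$, and $A(x;\lambda)\to A_\pm(\lambda)$ as $x\to\pm\infty$. Write $i_{\mathrm M}(A)$ for the number of eigenvalues of $A$ with positive real part, counted with algebraic multiplicity. When $A_\pm(\lambda)$ have no eigenvalues on the imaginary axis and $i_{\mathrm M}(A_+(\lambda))=i_{\mathrm M}(A_-(\lambda))=i_{\mathrm M}$, let $E^{\mathrm s}_+(x;\lambda)\in\mathrm{Gr}(N-i_{\mathrm M},N)$ and $E^{\mathrm u}_-(x;\lambda)\in\mathrm{Gr}(i_{\mathrm M},N)$ be the families of subspaces, continuous in $x$ and invariant under the flow of the equation, that converge, respectively, to the generalized eigenspace of $A_+(\lambda)$ to eigenvalues with negative real part as $x\to+\infty$, and to the generalized eigenspace of $A_-(\lambda)$ to eigenvalues with positive real part as $x\to-\infty$. Suppose that $E^{\mathrm s}_+(0;\lambda)$ and $E^{\mathrm u}_-(0;\lambda)$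 are analytic on $U$. Here, more generally, they may be analytic extensions: it is enough that they are families of subspaces of $\mathbb{C}^N$ that are analytic on $U$ and agree with the subspaces just described on an open set $U_0\subset U$ (where the conditions on $A_\pm(\lambda)$ hold) that meets every connected component of $U$. A family $E(\lambda)$ of subspaces is called analytic at $\lambda_0$ if, for some complement $F$ of $E(\lambda_0)$ and all $\lambda$ near $\lambda_0$, $E(\lambda)$ is the graph of a linear map $H(\lambda):E(\lambda_0)\to F$ that is analytic in $\lambda$. Then for every compact set $\Omega\subset U$ there are an open set $V$ with $\Omega\subset V\subset U$ and analytic functions $w^{\mathrm u}_j:V\to\mathbb{C}^N$, $1\le j\le i_{\mathrm M}$, and $w^{\mathrm s}_j:V\to\mathbb{C}^N$, $i_{\mathrm M}+1\le j\le N$, such that for every $\lambda\in V$ the vectors $w^{\mathrm u}_j(\lambda)$ form a basis of $E^{\mathrm u}_-(0;\lambda)$ and the vectors $w^{\mathrm s}_j(\lambda)$ form a basis of $E^{\mathrm s}_+(0;\lambda)$. -/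

import Mathlib

open Filter Topology

/-- The state space `ℂ^N` with its Hermitian norm. -/
abbrev CN (N : ℕ) : Type := EuclideanSpace ℂ (Fin N)

namespace TravelingWave

/-! ### Spectral data of the asymptotic matrices -/

/-- Sum of the generalized eigenspaces of `M` to eigenvalues with negative real part. -/
noncomputable def stableEigenspace {N : ℕ} (M : Matrix (Fin N) (Fin N) ℂ) : Submodule ℂ (CN N) :=
  ⨆ ν : {ν : ℂ // ν.re < 0}, Module.End.maxGenEigenspace (Matrix.toEuclideanLin M) ν.1

/-- Sum of the generalized eigenspaces of `M` to eigenvalues with positive real part. -/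
noncomputable def unstableEigenspace {N : ℕ} (M : Matrix (Fin N) (Fin N) ℂ) : Submodule ℂ (CN N) :=
  ⨆ ν : {ν : ℂ // 0 < ν.re}, Module.End.maxGenEigenspace (Matrix.toEuclideanLin M) ν.1

/-- `M` is hyperbolic: no eigenvalue lies on the imaginary axis. -/
def IsHyperbolic {N : ℕ} (M : Matrix (Fin N) (Fin N) ℂ) : Prop :=
  ∀ ν : ℂ, Module.End.HasEigenvalue (Matrix.toEuclideanLin M) ν → ν.re ≠ 0

/-- The Morse index: the number of eigenvalues with positive real part, counted with
algebraic multiplicity. -/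
noncomputable def morseIndex {N : ℕ} (M : Matrix (Fin N) (Fin N) ℂ) : ℕ :=
  Module.finrank ℂ (unstableEigenspace M)

/-! ### The linear equation `u_x = A(x; z) u` -/

/-- Standing assumptions on the coefficients for spectral parameters `z ∈ U`: `A(x; z)` is
continuous in `x`, analytic in `z`, and converges to `A_±(z)` as `x → ±∞`. -/
structure IsAsymptoticallyConstant {N : ℕ} (U : Set ℂ)
    (A : ℝ → ℂ → Matrix (Fin N) (Fin N) ℂ)
    (Aplus Aminus : ℂ → Matrix (Fin N) (Fin N) ℂ) : Prop where
  continuous : ∀ z ∈ U, Continuous fun x => A x z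
  analytic : ∀ (x : ℝ) (i j : Fin N), AnalyticOnNhd ℂ (fun z => A x z i j) U
  tendsto_atTop : ∀ z ∈ U, Tendsto (fun x => A x z) atTop (𝓝 (Aplus z))
  tendsto_atBot : ∀ z ∈ U, Tendsto (fun x => A x z) atBot (𝓝 (Aminus z))

/-- `u : ℝ → ℂ^N` solves `u' = a(x) u`. -/
def IsSolution {N : ℕ} (a : ℝ → Matrix (Fin N) (Fin N) ℂ) (u : ℝ → CN N) : Prop :=
  ∀ x : ℝ, HasDerivAt u (Matrix.toEuclideanLin (a x) (u x)) x

/-- `E` is a continuous curve in the Grassmannian `Gr(k, N)` that is invariant under the flow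
induced by `u' = a(x) u` on subspaces. The topology of `Gr(k, N)` is that of the orthogonal
projections in operator norm. -/
structure IsInvariantCurve {N : ℕ} (a : ℝ → Matrix (Fin N) (Fin N) ℂ) (k : ℕ)
    (E : ℝ → Submodule ℂ (CN N)) : Prop where
  finrank_eq : ∀ x, Module.finrank ℂ (E x) = k
  continuous : Continuous fun x => (E x).starProjection
  invariant : ∀ u : ℝ → CN N, IsSolution a u → ∀ x y : ℝ, u x ∈ E x → u y ∈ E y

/-- `E₀` is the subspace `E^s_+(0)` of `u' = a(x) u`: the value at `x = 0` of an invariant curve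
in `Gr(k, N)` that converges to the stable eigenspace of `aplus` as `x → +∞`. -/
def IsStableSubspaceAtZero {N : ℕ} (a : ℝ → Matrix (Fin N) (Fin N) ℂ)
    (aplus : Matrix (Fin N) (Fin N) ℂ) (k : ℕ) (E₀ : Submodule ℂ (CN N)) : Prop :=
  ∃ E : ℝ → Submodule ℂ (CN N), IsInvariantCurve a k E ∧
    Tendsto (fun x => (E x).starProjection) atTop (𝓝 (stableEigenspace aplus).starProjection) ∧
    E 0 = E₀

/-- `E₀` is the subspace `E^u_-(0)` of `u' = a(x) u`: the value at `x = 0` of an invariant curve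
in `Gr(k, N)` that converges to the unstable eigenspace of `aminus` as `x → -∞`. -/
def IsUnstableSubspaceAtZero {N : ℕ} (a : ℝ → Matrix (Fin N) (Fin N) ℂ)
    (aminus : Matrix (Fin N) (Fin N) ℂ) (k : ℕ) (E₀ : Submodule ℂ (CN N)) : Prop :=
  ∃ E : ℝ → Submodule ℂ (CN N), IsInvariantCurve a k E ∧
    Tendsto (fun x => (E x).starProjection) atBot (𝓝 (unstableEigenspace aminus).starProjection) ∧
    E 0 = E₀

/-! ### Analytic families of subspaces and analytic bases -/

/-- The family `E` of subspaces is analytic at `z₀`: in the chart of the Grassmannian given by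
some complement `F` of `E z₀`, it is near `z₀` the graph `{v + H(z) v : v ∈ E z₀}` of a linear map
`H(z) : E z₀ → F` that is analytic in `z`. -/
def AnalyticSubspaceAt {N : ℕ} (E : ℂ → Submodule ℂ (CN N)) (z₀ : ℂ) : Prop :=
  ∃ F : Submodule ℂ (CN N), IsCompl (E z₀) F ∧
    ∃ H : ℂ → (E z₀ →L[ℂ] F), AnalyticAt ℂ H z₀ ∧
      ∀ᶠ z in 𝓝 z₀,
        E z = LinearMap.range ((E z₀).subtype + F.subtype ∘ₗ (H z : E z₀ →ₗ[ℂ] F))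

/-- The vectors `w_j(z)`, `j < m`, depend analytically on `z ∈ V` and form, for every `z ∈ V`,
a basis of `E z`. -/
structure IsAnalyticBasisOn {N m : ℕ} (E : ℂ → Submodule ℂ (CN N)) (V : Set ℂ)
    (w : Fin m → ℂ → CN N) : Prop where
  analytic : ∀ j, AnalyticOnNhd ℂ (w j) V
  linearIndependent : ∀ z ∈ V, LinearIndependent ℂ fun j => w j z
  span_eq : ∀ z ∈ V, Submodule.span ℂ (Set.range fun j => w j z) = E z

/-- `Es z = E^s_+(0; z)` and `Eu z = E^u_-(0; z)` for `z ∈ U`. On an open set `U₀ ⊆ U` of parameters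
where `A_±(z)` are hyperbolic, both of Morse index `iM`, they are the subspaces determined by the
flow; on the rest of `U` they are the analytic extensions, that is, both are analytic on `U` and
every connected component of `U` meets `U₀`. For `U₀ = U` nothing is extended. -/
structure IsAnalyticStableUnstablePair {N : ℕ} (U : Set ℂ)
    (A : ℝ → ℂ → Matrix (Fin N) (Fin N) ℂ) (Aplus Aminus : ℂ → Matrix (Fin N) (Fin N) ℂ)
    (iM : ℕ) (Es Eu : ℂ → Submodule ℂ (CN N)) : Prop where
  analytic_stable : ∀ z ∈ U, AnalyticSubspaceAt Es z
  analytic_unstable : ∀ z ∈ U, AnalyticSubspaceAt Eu z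
  dynamic : ∃ U₀ : Set ℂ, IsOpen U₀ ∧ U₀ ⊆ U ∧
    (∀ z ∈ U, (connectedComponentIn U z ∩ U₀).Nonempty) ∧
    ∀ z ∈ U₀,
      IsHyperbolic (Aplus z) ∧ IsHyperbolic (Aminus z) ∧
      morseIndex (Aplus z) = iM ∧ morseIndex (Aminus z) = iM ∧
      IsStableSubspaceAtZero (fun x => A x z) (Aplus z) (N - iM) (Es z) ∧
      IsUnstableSubspaceAtZero (fun x => A x z) (Aminus z) iM (Eu z)

end TravelingWave

/-!
An analytic family of subspaces is an analytic subbundle of the trivial bundle over `U`, and near a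
compact set such a bundle is trivial. Only its rank comes from the differential equation: the rank
is locally constant and is prescribed on `U₀`, which meets every connected component of `U`.

On a connected component, fix one member `E z₁` of the family and a projection `π` onto it. The
points `z` where `π` is not an isomorphism on `E z` are the zeros of determinants that are analytic
in local frames, so by the identity principle they form a discrete closed set. Away from these
points the vectors of `E z` with prescribed coordinates under `π` form an analytic frame, and by
Cramer's rule the frame is meromorphic at the singular points
(`exists_isMeromorphicFrameOn_of_isPreconnected`).

A relatively compact neighbourhood `V` of `Ω` contains only finitely many singular points, and they
can be removed one at a time (`IsMeromorphicFrameOn.exists_isFrameAt`). In a local frame at the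
singular point `z₀` the given frame is a meromorphic matrix function `M`. Multiplication by a power
of `z - z₀` makes it analytic; then, as long as `M z₀` has a kernel vector `c`, one column is
replaced by `M c / (z - z₀)`, which lowers the order of `det M` at `z₀`
(`exists_invertible_extension`). These changes of basis are analytic and invertible on all of
`ℂ ∖ {z₀}`, so no new singular points arise.
-/

namespace TravelingWave

/-! ### Matrices of analytic functions of one variable -/

theorem analyticAt_det {k : ℕ} {M : ℂ → Matrix (Fin k) (Fin k) ℂ} {z₀ : ℂ}
    (hM : ∀ i j, AnalyticAt ℂ (fun z => M z i j) z₀) :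
    AnalyticAt ℂ (fun z => (M z).det) z₀ := by
  simp only [Matrix.det_apply']
  exact Finset.analyticAt_fun_sum _ fun σ _ =>
    analyticAt_const.mul (Finset.analyticAt_fun_prod _ fun i _ => hM _ _)

theorem analyticAt_mul_apply {k : ℕ} {M R : ℂ → Matrix (Fin k) (Fin k) ℂ} {z₀ : ℂ}
    (hM : ∀ i j, AnalyticAt ℂ (fun z => M z i j) z₀)
    (hR : ∀ i j, AnalyticAt ℂ (fun z => R z i j) z₀) (i j : Fin k) :
    AnalyticAt ℂ (fun z => (M z * R z) i j) z₀ := by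
  simp only [Matrix.mul_apply]
  exact Finset.analyticAt_fun_sum _ fun l _ => (hM i l).mul (hR l j)

theorem analyticAt_dslope {f : ℂ → ℂ} {z₀ : ℂ} (hf : AnalyticAt ℂ f z₀) :
    AnalyticAt ℂ (dslope f z₀) z₀ := by
  obtain ⟨p, hp⟩ := hf
  exact ⟨_, hp.has_fpower_series_dslope_fslope⟩

theorem analyticAt_inv_apply {k : ℕ} {M : ℂ → Matrix (Fin k) (Fin k) ℂ} {z₀ : ℂ}
    (hM : ∀ i j, AnalyticAt ℂ (fun z => M z i j) z₀) (h0 : (M z₀).det ≠ 0) (i j : Fin k) :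
    AnalyticAt ℂ (fun z => (M z)⁻¹ i j) z₀ := by
  simp only [Matrix.inv_def, Matrix.smul_apply, Ring.inverse_eq_inv', Matrix.adjugate_apply,
    smul_eq_mul]
  refine ((analyticAt_det hM).inv h0).mul (analyticAt_det fun a b => ?_)
  by_cases h : a = j
  · simpa [Matrix.updateRow_apply, h] using analyticAt_const
  · simpa [Matrix.updateRow_apply, h] using hM a b

theorem meromorphicAt_inv_apply {k : ℕ} {M : ℂ → Matrix (Fin k) (Fin k) ℂ} {z₀ : ℂ}
    (hM : ∀ i j, AnalyticAt ℂ (fun z => M z i j) z₀) (i j : Fin k) :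
    MeromorphicAt (fun z => (M z)⁻¹ i j) z₀ := by
  simp only [Matrix.inv_def, Matrix.smul_apply, Ring.inverse_eq_inv', Matrix.adjugate_apply,
    smul_eq_mul]
  refine (analyticAt_det hM).meromorphicAt.fun_inv.fun_mul
    (analyticAt_det fun a b => ?_).meromorphicAt
  by_cases h : a = j
  · simpa [Matrix.updateRow_apply, h] using analyticAt_const
  · simpa [Matrix.updateRow_apply, h] using hM a b

/-- If the determinant of an analytic matrix function `M` vanishes to order `n` at `z₀`, then
right multiplication by a matrix function `R` that is analytic and invertible away from `z₀`
makes it analytic and invertible at `z₀`. Each step of the induction takes a kernel vector `c` of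
`M z₀`, replaces a column by `M c / (z - z₀)`, and lowers the order of the determinant by one. -/
theorem exists_invertible_extension_of_det_eq {k : ℕ} {z₀ : ℂ} (n : ℕ) :
    ∀ (M : ℂ → Matrix (Fin k) (Fin k) ℂ) (g : ℂ → ℂ),
      (∀ i j, AnalyticAt ℂ (fun z => M z i j) z₀) → AnalyticAt ℂ g z₀ → g z₀ ≠ 0 →
      (∀ᶠ z in 𝓝 z₀, (M z).det = (z - z₀) ^ n * g z) →
      ∃ R M' : ℂ → Matrix (Fin k) (Fin k) ℂ,
        (∀ z ≠ z₀, (∀ i j, AnalyticAt ℂ (fun w => R w i j) z) ∧ (R z).det ≠ 0) ∧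
        (∀ i j, AnalyticAt ℂ (fun z => M' z i j) z₀) ∧ (M' z₀).det ≠ 0 ∧
        ∀ z ≠ z₀, M z * R z = M' z := by
  induction n with
  | zero =>
    intro M g hM _ hg0 hdet
    refine ⟨fun _ => 1, M, fun z _ => ⟨fun i j => analyticAt_const, by simp⟩, hM, ?_, by simp⟩
    simpa [hdet.self_of_nhds] using hg0
  | succ n ih =>
    intro M g hM hg hg0 hdet
    have h0 : (M z₀).det = 0 := by simp [hdet.self_of_nhds]
    obtain ⟨c, hc, hMc⟩ := Matrix.exists_mulVec_eq_zero_iff.2 h0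
    obtain ⟨i, hi⟩ := Function.ne_iff.1 hc
    let f : Fin k → ℂ → ℂ := fun r w => (M w).mulVec c r
    have hf : ∀ r, AnalyticAt ℂ (f r) z₀ := fun r => by
      simp only [f, Matrix.mulVec, dotProduct]
      exact Finset.analyticAt_fun_sum _ fun l _ => (hM r l).mul analyticAt_const
    let M₁ : ℂ → Matrix (Fin k) (Fin k) ℂ := fun z =>
      (M z).updateCol i fun r => dslope (f r) z₀ z
    let R₁ : ℂ → Matrix (Fin k) (Fin k) ℂ := fun z =>
      (1 : Matrix (Fin k) (Fin k) ℂ).updateCol i ((z - z₀)⁻¹ • c)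
    have hM₁ : ∀ a b, AnalyticAt ℂ (fun z => M₁ z a b) z₀ := fun a b => by
      by_cases h : b = i
      · simpa [M₁, Matrix.updateCol_apply, h] using analyticAt_dslope (hf a)
      · simpa [M₁, Matrix.updateCol_apply, h] using hM a b
    have hR₁ : ∀ z ≠ z₀, ∀ a b, AnalyticAt ℂ (fun w => R₁ w a b) z := fun z hz a b => by
      by_cases h : b = i
      · simp only [R₁, Matrix.updateCol_apply, h, if_true, Pi.smul_apply, smul_eq_mul]
        exact ((analyticAt_id.sub analyticAt_const).inv (sub_ne_zero.2 hz)).mul analyticAt_const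
      · simp only [R₁, Matrix.updateCol_apply, h, if_false]
        exact analyticAt_const
    have hdR₁ : ∀ z, (R₁ z).det = (z - z₀)⁻¹ * c i := fun z => by
      simp only [R₁]
      rw [← Matrix.cramer_apply, Matrix.cramer_one]
      simp
    have hMR₁ : ∀ z ≠ z₀, M z * R₁ z = M₁ z := fun z hz => by
      simp only [R₁, M₁]
      rw [Matrix.mul_updateCol, mul_one]
      congr 1
      funext r
      have : f r z₀ = 0 := congrFun hMc r
      rw [dslope_of_ne _ hz, slope_def_field, this, Matrix.mulVec_smul]
      simp [f, div_eq_inv_mul]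
    have hdet₁ : ∀ᶠ z in 𝓝 z₀, (M₁ z).det = (z - z₀) ^ n * (c i * g z) := by
      refine ((analyticAt_det hM₁).frequently_eq_iff_eventually_eq ?_).1 (Eventually.frequently ?_)
      · exact ((analyticAt_id.sub analyticAt_const).pow n).mul (analyticAt_const.mul hg)
      · filter_upwards [hdet.filter_mono nhdsWithin_le_nhds, self_mem_nhdsWithin] with z hz hne
        have : z - z₀ ≠ 0 := sub_ne_zero.2 hne
        rw [← hMR₁ z hne, Matrix.det_mul, hz, hdR₁]
        field_simp
        ring
    obtain ⟨R, M', hR, hM', hd', hMR⟩ :=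
      ih M₁ (fun z => c i * g z) hM₁ (analyticAt_const.mul hg) (mul_ne_zero hi hg0) hdet₁
    refine ⟨fun z => R₁ z * R z, M', fun z hz => ⟨analyticAt_mul_apply (hR₁ z hz) (hR z hz).1, ?_⟩,
      hM', hd', fun z hz => ?_⟩
    · rw [Matrix.det_mul, hdR₁]
      exact mul_ne_zero (mul_ne_zero (inv_ne_zero (sub_ne_zero.2 hz)) hi) (hR z hz).2
    · rw [← Matrix.mul_assoc, hMR₁ z hz, hMR z hz]

/-- The local form of the removal of a singular point: a meromorphic matrix function that is
invertible on a punctured neighbourhood of `z₀` becomes analytic and invertible at `z₀` after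
right multiplication by a matrix function that is analytic and invertible away from `z₀`. -/
theorem exists_invertible_extension {k : ℕ} {z₀ : ℂ} (M : ℂ → Matrix (Fin k) (Fin k) ℂ)
    (hM : ∀ i j, MeromorphicAt (fun z => M z i j) z₀) (hdet : ∀ᶠ z in 𝓝[≠] z₀, (M z).det ≠ 0) :
    ∃ R M' : ℂ → Matrix (Fin k) (Fin k) ℂ,
      (∀ z ≠ z₀, (∀ i j, AnalyticAt ℂ (fun w => R w i j) z) ∧ (R z).det ≠ 0) ∧
      (∀ i j, AnalyticAt ℂ (fun z => M' z i j) z₀) ∧ (M' z₀).det ≠ 0 ∧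
      ∀ z ≠ z₀, M z * R z = M' z := by
  choose p hp using hM
  -- a common bound for the orders of the poles of the entries
  let n : ℕ := ∑ i, ∑ j, p i j
  have hn : ∀ i j, p i j ≤ n := fun i j =>
    (Finset.single_le_sum (f := fun j => p i j) (fun _ _ => Nat.zero_le _)
      (Finset.mem_univ j)).trans
      (Finset.single_le_sum (f := fun i => ∑ j, p i j) (fun _ _ => Nat.zero_le _)
        (Finset.mem_univ i))
  let M₀ : ℂ → Matrix (Fin k) (Fin k) ℂ := fun z => (z - z₀) ^ n • M z
  have hM₀ : ∀ i j, AnalyticAt ℂ (fun z => M₀ z i j) z₀ := fun i j => by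
    have h : (fun z => M₀ z i j) =
        fun z => (z - z₀) ^ (n - p i j) * ((z - z₀) ^ p i j • M z i j) := by
      funext z
      simp only [M₀, Matrix.smul_apply, smul_eq_mul]
      rw [← mul_assoc, ← pow_add, Nat.sub_add_cancel (hn i j)]
    rw [h]
    exact ((analyticAt_id.sub analyticAt_const).pow _).mul (hp i j)
  have hdet₀ : ¬ ∀ᶠ z in 𝓝 z₀, (M₀ z).det = 0 := fun h => by
    obtain ⟨z, ⟨hz, hz'⟩, hne⟩ :=
      (((h.filter_mono nhdsWithin_le_nhds).and hdet).and self_mem_nhdsWithin).exists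
    rw [Matrix.det_smul] at hz
    exact mul_ne_zero (pow_ne_zero _ (pow_ne_zero _ (sub_ne_zero.2 hne))) hz' hz
  obtain ⟨m, g, hg, hg0, hfac⟩ :=
    (analyticAt_det hM₀).exists_eventuallyEq_pow_smul_nonzero_iff.2 hdet₀
  obtain ⟨R, M', hR, hM', hd', hMR⟩ :=
    exists_invertible_extension_of_det_eq m M₀ g hM₀ hg hg0 (by simpa using hfac)
  refine ⟨fun z => (z - z₀) ^ n • R z, M', fun z hz => ⟨fun i j => ?_, ?_⟩, hM', hd',
    fun z hz => ?_⟩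
  · exact ((analyticAt_id.sub analyticAt_const).pow _).mul ((hR z hz).1 i j)
  · rw [Matrix.det_smul]
    exact mul_ne_zero (pow_ne_zero _ (pow_ne_zero _ (sub_ne_zero.2 hz))) (hR z hz).2
  · rw [← hMR z hz]
    simp [M₀]

/-! ### Changes of basis of a subspace -/

section LinearAlgebra

variable {X : Type*} [AddCommGroup X] [Module ℂ X] {k : ℕ}

/-- The vectors `v j`, `j < k`, form a basis of the subspace `E`. -/
structure IsBasisOf (E : Submodule ℂ X) (v : Fin k → X) : Prop where
  linearIndependent : LinearIndependent ℂ v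
  span_eq : Submodule.span ℂ (Set.range v) = E

theorem IsBasisOf.mem {E : Submodule ℂ X} {v : Fin k → X} (h : IsBasisOf E v) (j : Fin k) :
    v j ∈ E :=
  h.span_eq ▸ Submodule.subset_span ⟨j, rfl⟩

theorem IsBasisOf.sum_smul {E : Submodule ℂ X} {v : Fin k → X} (h : IsBasisOf E v)
    {R : Matrix (Fin k) (Fin k) ℂ} (hR : R.det ≠ 0) :
    IsBasisOf E fun j => ∑ i, R i j • v i := by
  have hu : IsUnit R.det := isUnit_iff_ne_zero.2 hR
  have hspan : Submodule.span ℂ (Set.range fun j => ∑ i, R i j • v i) = E := by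
    apply le_antisymm
    · rw [Submodule.span_le]
      rintro _ ⟨j, rfl⟩
      exact E.sum_mem fun i _ => E.smul_mem _ (h.mem i)
    · rw [← h.span_eq, Submodule.span_le]
      rintro _ ⟨l, rfl⟩
      have : v l = ∑ j, R⁻¹ j l • ∑ i, R i j • v i := by
        simp_rw [Finset.smul_sum, smul_smul]
        rw [Finset.sum_comm]
        simp_rw [← Finset.sum_smul, mul_comm (R⁻¹ _ _), ← Matrix.mul_apply,
          Matrix.mul_nonsing_inv R hu, Matrix.one_apply]
        simp
      rw [this]
      exact Submodule.sum_mem _ fun j _ =>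
        Submodule.smul_mem _ _ (Submodule.subset_span ⟨j, rfl⟩)
  refine ⟨?_, hspan⟩
  rw [linearIndependent_iff_card_eq_finrank_span, Set.finrank, hspan, ← h.span_eq,
    ← Set.finrank, ← linearIndependent_iff_card_eq_finrank_span]
  exact h.linearIndependent

theorem isBasisOf_of_map_eq_single {E : Submodule ℂ X} {e : Fin k → X} (π : X →ₗ[ℂ] Fin k → ℂ)
    (hπ : ∀ j, π (e j) = Pi.single j 1) (hspan : Submodule.span ℂ (Set.range e) = E) :
    IsBasisOf E e := by
  refine ⟨LinearIndependent.of_comp π ?_, hspan⟩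
  have : (π ∘ e) = Pi.basisFun ℂ (Fin k) := by
    funext j
    simp [hπ]
  rw [this]
  exact (Pi.basisFun ℂ (Fin k)).linearIndependent

theorem eq_sum_of_mem_span {e : Fin k → X} (π : X →ₗ[ℂ] Fin k → ℂ)
    (hπ : ∀ j, π (e j) = Pi.single j 1) {x : X} (hx : x ∈ Submodule.span ℂ (Set.range e)) :
    x = ∑ l, π x l • e l := by
  obtain ⟨a, rfl⟩ := (Submodule.mem_span_range_iff_exists_fun ℂ).1 hx
  refine Finset.sum_congr rfl fun l _ => ?_
  simp [hπ, Finset.sum_apply, Pi.single_apply]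

/-- The matrix whose columns are the coordinate vectors `π (v j)`. -/
def coordMatrix (π : X →ₗ[ℂ] Fin k → ℂ) (v : Fin k → X) : Matrix (Fin k) (Fin k) ℂ :=
  Matrix.of fun l j => π (v j) l

theorem det_coordMatrix_ne_zero {E : Submodule ℂ X} {e v : Fin k → X} (π : X →ₗ[ℂ] Fin k → ℂ)
    (hπ : ∀ j, π (e j) = Pi.single j 1) (hspan : Submodule.span ℂ (Set.range e) = E)
    (hv : IsBasisOf E v) : (coordMatrix π v).det ≠ 0 := fun h0 => by
  obtain ⟨c, hc, hMc⟩ := Matrix.exists_mulVec_eq_zero_iff.2 h0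
  have hx : ∑ j, c j • v j ∈ Submodule.span ℂ (Set.range e) :=
    hspan ▸ E.sum_mem fun j _ => E.smul_mem _ (hv.mem j)
  have hπx : π (∑ j, c j • v j) = 0 := by
    rw [← hMc]
    funext l
    simp [coordMatrix, Matrix.mulVec, dotProduct, mul_comm]
  have hzero : ∑ j, c j • v j = 0 := by
    rw [eq_sum_of_mem_span π hπ hx, hπx]
    simp
  exact hc (funext (Fintype.linearIndependent_iff.1 hv.linearIndependent c hzero))

end LinearAlgebra


/-! ### Local and meromorphic frames of a family of subspaces -/

/-- The functions `s j` are analytic at `z`, and their values at `z` form a basis of `E z`. -/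
structure IsFrameAt {N k : ℕ} (E : ℂ → Submodule ℂ (CN N)) (s : Fin k → ℂ → CN N) (z : ℂ) :
    Prop where
  analyticAt : ∀ j, AnalyticAt ℂ (s j) z
  isBasisOf : IsBasisOf (E z) fun j => s j z

/-- The functions `s j` are meromorphic on `U` and form an analytic frame of `E` off a subset of
`U` that is discrete and closed in `U`. -/
structure IsMeromorphicFrameOn {N k : ℕ} (E : ℂ → Submodule ℂ (CN N)) (U : Set ℂ)
    (s : Fin k → ℂ → CN N) : Prop where
  meromorphicAt : ∀ z ∈ U, ∀ j, MeromorphicAt (s j) z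
  eventually_isFrameAt : ∀ z ∈ U, ∀ᶠ w in 𝓝[≠] z, IsFrameAt E s w

variable {N k : ℕ} {E : ℂ → Submodule ℂ (CN N)}

theorem IsFrameAt.congr {s t : Fin k → ℂ → CN N} {z : ℂ} (h : IsFrameAt E s z)
    (hst : ∀ᶠ w in 𝓝 z, ∀ j, s j w = t j w) : IsFrameAt E t z := by
  refine ⟨fun j => (h.analyticAt j).congr (hst.mono fun w hw => hw j), ?_⟩
  simpa only [hst.self_of_nhds] using h.isBasisOf

theorem analyticAt_coordMatrix (π : CN N →ₗ[ℂ] Fin k → ℂ) {s : Fin k → ℂ → CN N} {z : ℂ}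
    (hs : ∀ j, AnalyticAt ℂ (s j) z) (l j : Fin k) :
    AnalyticAt ℂ (fun w => (coordMatrix π fun j => s j w) l j) z :=
  (((ContinuousLinearMap.proj (R := ℂ) (φ := fun _ : Fin k => ℂ) l).comp
    (LinearMap.toContinuousLinearMap π)).analyticAt _).comp (hs j)

theorem meromorphicAt_coordMatrix (π : CN N →ₗ[ℂ] Fin k → ℂ) {s : Fin k → ℂ → CN N} {z : ℂ}
    (hs : ∀ j, MeromorphicAt (s j) z) (l j : Fin k) :
    MeromorphicAt (fun w => (coordMatrix π fun j => s j w) l j) z := by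
  obtain ⟨n, hn⟩ := hs j
  refine ⟨n, ?_⟩
  have h := (((ContinuousLinearMap.proj (R := ℂ) (φ := fun _ : Fin k => ℂ) l).comp
    (LinearMap.toContinuousLinearMap π)).analyticAt _).comp hn
  refine h.congr (Eventually.of_forall fun w => ?_)
  simp [coordMatrix]

theorem analyticAt_sum_smul {s : Fin k → ℂ → CN N} {R : ℂ → Matrix (Fin k) (Fin k) ℂ} {z : ℂ}
    (hs : ∀ j, AnalyticAt ℂ (s j) z) (hR : ∀ i j, AnalyticAt ℂ (fun w => R w i j) z) (j : Fin k) :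
    AnalyticAt ℂ (fun w => ∑ i, R w i j • s i w) z :=
  Finset.analyticAt_fun_sum _ fun i _ => (hR i j).smul (hs i)

theorem IsFrameAt.sum_smul {s : Fin k → ℂ → CN N} {R : ℂ → Matrix (Fin k) (Fin k) ℂ} {z : ℂ}
    (h : IsFrameAt E s z) (hR : ∀ i j, AnalyticAt ℂ (fun w => R w i j) z) (hdet : (R z).det ≠ 0) :
    IsFrameAt E (fun j w => ∑ i, R w i j • s i w) z :=
  ⟨analyticAt_sum_smul h.analyticAt hR, h.isBasisOf.sum_smul hdet⟩

/-- An analytic family of subspaces has a local analytic frame `e` that is dual to a coordinate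
map `π` not depending on `z`: in the graph chart, `π` is the projection along the complement. -/
theorem AnalyticSubspaceAt.exists_frame {z₀ : ℂ} (h : AnalyticSubspaceAt E z₀)
    (hk : Module.finrank ℂ (E z₀) = k) :
    ∃ (e : Fin k → ℂ → CN N) (π : CN N →ₗ[ℂ] Fin k → ℂ), (∀ j z, π (e j z) = Pi.single j 1) ∧
      ∀ᶠ z in 𝓝 z₀, IsFrameAt E e z := by
  obtain ⟨F, hF, H, hH, hE⟩ := h
  let b := Module.finBasisOfFinrankEq ℂ (E z₀) hk
  let e : Fin k → ℂ → CN N := fun j z => (b j : CN N) + (H z (b j) : CN N)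
  let π : CN N →ₗ[ℂ] Fin k → ℂ :=
    b.equivFun.toLinearMap ∘ₗ (E z₀).projectionOnto F hF
  have hπ : ∀ j z, π (e j z) = Pi.single j 1 := fun j z => by
    funext l
    simp [π, e, Pi.single_apply, eq_comm]
  refine ⟨e, π, hπ, ?_⟩
  filter_upwards [hE, hH.eventually_analyticAt] with z hz hHz
  refine ⟨fun j => ?_, isBasisOf_of_map_eq_single π (fun j => hπ j z) ?_⟩
  · refine analyticAt_const.add ?_
    exact ((F.subtypeL.comp (ContinuousLinearMap.apply ℂ F (b j))).analyticAt _).comp hHz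
  · rw [hz, LinearMap.range_eq_map, ← b.span_eq, Submodule.map_span, ← Set.range_comp]
    rfl

theorem AnalyticSubspaceAt.eventually_finrank_eq {z₀ : ℂ} (h : AnalyticSubspaceAt E z₀) :
    ∀ᶠ z in 𝓝 z₀, Module.finrank ℂ (E z) = Module.finrank ℂ (E z₀) := by
  obtain ⟨e, π, -, he⟩ := h.exists_frame rfl
  filter_upwards [he] with z hz
  rw [← hz.isBasisOf.span_eq, finrank_span_eq_card hz.isBasisOf.linearIndependent,
    Fintype.card_fin]

theorem finrank_eq_of_isPreconnected {C : Set ℂ} (hC : IsPreconnected C)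
    (hE : ∀ z ∈ C, AnalyticSubspaceAt E z) {z w : ℂ} (hz : z ∈ C) (hw : w ∈ C) :
    Module.finrank ℂ (E z) = Module.finrank ℂ (E w) := by
  refine hC.constant (f := fun z => Module.finrank ℂ (E z)) (fun x hx => ?_) hz hw
  exact (tendsto_nhds_of_eventually_eq (hE x hx).eventually_finrank_eq).mono_left
    nhdsWithin_le_nhds

/-- Identity principle for a property that near each point of `C` either fails identically or
holds on a punctured neighbourhood. -/
theorem eventually_nhdsNE_of_isPreconnected {C : Set ℂ} (hC : IsPreconnected C) {p : ℂ → Prop}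
    (hp : ∀ z ∈ C, (∀ᶠ w in 𝓝 z, ¬ p w) ∨ ∀ᶠ w in 𝓝[≠] z, p w) {z₀ : ℂ} (hz₀ : z₀ ∈ C)
    (h₀ : p z₀) {z : ℂ} (hz : z ∈ C) : ∀ᶠ w in 𝓝[≠] z, p w := by
  classical
  have hcont : ContinuousOn (fun z => (if ∀ᶠ w in 𝓝 z, ¬ p w then 1 else 0 : ℕ)) C := by
    intro x hx
    refine (tendsto_nhds_of_eventually_eq ?_).mono_left nhdsWithin_le_nhds
    rcases hp x hx with h | h
    · filter_upwards [eventually_eventually_nhds.2 h] with y hy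
      rw [if_pos hy, if_pos h]
    · have hne : ∀ᶠ y in 𝓝 x, ¬ ∀ᶠ w in 𝓝 y, ¬ p w := by
        filter_upwards [eventually_eventually_nhds.2 (eventually_nhdsWithin_iff.1 h)] with y hy hy'
        have hyx : ∀ᶠ w in 𝓝[≠] y, w ≠ x := by
          rcases eq_or_ne y x with rfl | hne
          · exact self_mem_nhdsWithin
          · exact eventually_ne_nhdsWithin hne
        obtain ⟨w, ⟨hw, hw'⟩, hwx⟩ :=
          (((hy.and hy').filter_mono nhdsWithin_le_nhds).and hyx).exists
        exact hw' (hw hwx)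
      filter_upwards [hne] with y hy
      rw [if_neg hy, if_neg hne.self_of_nhds]
  have h := hC.constant hcont hz hz₀
  have hn : ¬ ∀ᶠ w in 𝓝 z₀, ¬ p w := fun h => h.self_of_nhds h₀
  refine (hp z hz).resolve_left fun h' => ?_
  simp only [if_neg hn, if_pos h'] at h
  exact one_ne_zero h

/-- On a connected set an analytic family of subspaces has a meromorphic frame: the vectors of
`E z` with prescribed coordinates under a projection onto one member of the family. -/
theorem exists_isMeromorphicFrameOn_of_isPreconnected {C : Set ℂ} (hC : IsPreconnected C)
    (hE : ∀ z ∈ C, AnalyticSubspaceAt E z) (hk : ∀ z ∈ C, Module.finrank ℂ (E z) = k) :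
    ∃ s : Fin k → ℂ → CN N, IsMeromorphicFrameOn E C s := by
  rcases C.eq_empty_or_nonempty with rfl | ⟨z₁, hz₁⟩
  · exact ⟨fun _ _ => 0, by simp, by simp⟩
  obtain ⟨e₁, π, hπ, he₁⟩ := (hE z₁ hz₁).exists_frame (hk z₁ hz₁)
  -- `p z` says that `π` restricts to an isomorphism on `E z`
  let p : ℂ → Prop := fun z => ∃ v : Fin k → CN N,
    (∀ j, π (v j) = Pi.single j 1) ∧ Submodule.span ℂ (Set.range v) = E z
  classical
  let s : Fin k → ℂ → CN N := fun j z => if h : p z then h.choose j else 0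
  have hp₁ : p z₁ := ⟨fun j => e₁ j z₁, fun j => hπ j z₁, he₁.self_of_nhds.isBasisOf.span_eq⟩
  have hs : ∀ z, p z → (∀ j, π (s j z) = Pi.single j 1) ∧
      Submodule.span ℂ (Set.range fun j => s j z) = E z := fun z h => by
    simpa only [s, dif_pos h] using h.choose_spec
  -- in a local frame `e`, the sections `s j` are given by the inverse of the coordinate
  -- matrix; where this matrix is singular both sides are zero, as `⁻¹` is then zero
  have hlocal : ∀ z {e : Fin k → ℂ → CN N}, IsFrameAt E e z →
      (p z ↔ (coordMatrix π fun j => e j z).det ≠ 0) ∧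
      ∀ j, s j z = ∑ i, (coordMatrix π fun j => e j z)⁻¹ i j • e i z := by
    intro z e he
    set K := coordMatrix π fun j => e j z with hK
    have hπv : K.det ≠ 0 → ∀ j, π (∑ i, K⁻¹ i j • e i z) = Pi.single j 1 := fun h j => by
      funext l
      have : (K * K⁻¹) l j = (1 : Matrix (Fin k) (Fin k) ℂ) l j := by
        rw [Matrix.mul_nonsing_inv K (isUnit_iff_ne_zero.2 h)]
      rw [Matrix.mul_apply, Matrix.one_apply] at this
      simpa [hK, coordMatrix, Pi.single_apply, mul_comm] using this
    have hbasis : K.det ≠ 0 → IsBasisOf (E z) fun j => ∑ i, K⁻¹ i j • e i z := fun h =>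
      he.isBasisOf.sum_smul (by simpa [Matrix.det_nonsing_inv] using h)
    have hiff : p z ↔ K.det ≠ 0 :=
      ⟨fun h => det_coordMatrix_ne_zero π (hs z h).1 (hs z h).2 he.isBasisOf,
        fun h => ⟨_, hπv h, (hbasis h).span_eq⟩⟩
    refine ⟨hiff, fun j => ?_⟩
    by_cases h : p z
    · have hmem : ∑ i, K⁻¹ i j • e i z ∈ Submodule.span ℂ (Set.range fun j => s j z) :=
        (hs z h).2 ▸ (hbasis (hiff.1 h)).mem j
      rw [eq_sum_of_mem_span π (hs z h).1 hmem, hπv (hiff.1 h)]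
      simp [Pi.single_apply]
    · have hdet : ¬ IsUnit K.det := by
        rw [isUnit_iff_ne_zero]
        exact fun h' => h (hiff.2 h')
      simp [s, dif_neg h, Matrix.nonsing_inv_apply_not_isUnit K hdet]
  have hp : ∀ z ∈ C, (∀ᶠ w in 𝓝 z, ¬ p w) ∨ ∀ᶠ w in 𝓝[≠] z, p w := fun z hz => by
    obtain ⟨e, _, -, he⟩ := (hE z hz).exists_frame (hk z hz)
    rcases (analyticAt_det (analyticAt_coordMatrix π
      he.self_of_nhds.analyticAt)).eventually_eq_zero_or_eventually_ne_zero with h | h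
    · left
      filter_upwards [h, he] with w hw hew
      rw [(hlocal w hew).1, not_not]
      exact hw
    · right
      filter_upwards [h, he.filter_mono nhdsWithin_le_nhds] with w hw hew
      exact (hlocal w hew).1.2 hw
  refine ⟨s, fun z hz j => ?_, fun z hz => ?_⟩
  · obtain ⟨e, _, -, he⟩ := (hE z hz).exists_frame (hk z hz)
    have hK := analyticAt_coordMatrix π he.self_of_nhds.analyticAt
    have hmer : MeromorphicAt
        (fun w => ∑ i, (coordMatrix π fun j => e j w)⁻¹ i j • e i w) z :=
      MeromorphicAt.fun_sum fun i _ =>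
        (meromorphicAt_inv_apply hK i j).fun_smul (he.self_of_nhds.analyticAt i).meromorphicAt
    refine hmer.congr (EventuallyEq.filter_mono ?_ nhdsWithin_le_nhds)
    filter_upwards [he] with w hw
    exact ((hlocal w hw).2 j).symm
  · obtain ⟨e, _, -, he⟩ := (hE z hz).exists_frame (hk z hz)
    filter_upwards [eventually_nhdsNE_of_isPreconnected hC hp hz₁ hp₁ hz,
      (eventually_eventually_nhds.2 he).filter_mono nhdsWithin_le_nhds] with w hw hew
    have hdet := (hlocal w hew.self_of_nhds).1.1 hw
    have hK := analyticAt_coordMatrix π hew.self_of_nhds.analyticAt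
    refine (hew.self_of_nhds.sum_smul (analyticAt_inv_apply hK hdet) ?_).congr ?_
    · simpa [Matrix.det_nonsing_inv] using hdet
    · filter_upwards [hew] with x hx j
      exact ((hlocal x hx).2 j).symm

/-- On an open set the meromorphic frames of the connected components fit together. -/
theorem exists_isMeromorphicFrameOn {U : Set ℂ} (hU : IsOpen U)
    (hE : ∀ z ∈ U, AnalyticSubspaceAt E z) (hk : ∀ z ∈ U, Module.finrank ℂ (E z) = k) :
    ∃ s : Fin k → ℂ → CN N, IsMeromorphicFrameOn E U s := by
  have h : ∀ z₀, ∃ s : Fin k → ℂ → CN N, IsMeromorphicFrameOn E (connectedComponentIn U z₀) s :=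
    fun z₀ => exists_isMeromorphicFrameOn_of_isPreconnected isPreconnected_connectedComponentIn
      (fun z hz => hE z (connectedComponentIn_subset U z₀ hz))
      (fun z hz => hk z (connectedComponentIn_subset U z₀ hz))
  -- one frame for each connected component, so that the union of the frames is locally one of them
  have h' : ∀ C : Set ℂ, ∃ s : Fin k → ℂ → CN N, (∃ z, C = connectedComponentIn U z) →
      IsMeromorphicFrameOn E C s := fun C => by
    by_cases hC : ∃ z, C = connectedComponentIn U z
    · obtain ⟨z, rfl⟩ := hC
      exact (h z).imp fun s hs _ => hs
    · exact ⟨fun _ _ => 0, fun h => absurd h hC⟩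
  choose σ hσ using h'
  have hloc : ∀ z ∈ U, ∀ᶠ w in 𝓝 z, ∀ j,
      σ (connectedComponentIn U z) j w = σ (connectedComponentIn U w) j w := fun z hz => by
    filter_upwards [connectedComponentIn_mem_nhds (hU.mem_nhds hz)] with w hw j
    rw [connectedComponentIn_eq hw]
  refine ⟨fun j z => σ (connectedComponentIn U z) j z, fun z hz j => ?_, fun z hz => ?_⟩
  · refine ((hσ _ ⟨z, rfl⟩).meromorphicAt z (mem_connectedComponentIn hz) j).congr ?_
    exact ((hloc z hz).mono fun w hw => hw j).filter_mono nhdsWithin_le_nhds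
  · filter_upwards [(hσ _ ⟨z, rfl⟩).eventually_isFrameAt z (mem_connectedComponentIn hz),
      (eventually_eventually_nhds.2 (hloc z hz)).filter_mono nhdsWithin_le_nhds] with w hw hw'
    exact hw.congr hw'

/-! ### Removal of the singular points -/

/-- A meromorphic frame can be changed into one that is an analytic frame at a given point `z₀`,
without creating new singular points: the change of basis is analytic and invertible off `z₀`. -/
theorem IsMeromorphicFrameOn.exists_isFrameAt {V : Set ℂ} {s : Fin k → ℂ → CN N}
    (hs : IsMeromorphicFrameOn E V s) {z₀ : ℂ} (hz₀ : z₀ ∈ V) (hE : AnalyticSubspaceAt E z₀)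
    (hk : Module.finrank ℂ (E z₀) = k) :
    ∃ t : Fin k → ℂ → CN N, IsMeromorphicFrameOn E V t ∧ IsFrameAt E t z₀ ∧
      ∀ z ≠ z₀, IsFrameAt E s z → IsFrameAt E t z := by
  obtain ⟨e, π, hπ, he⟩ := hE.exists_frame hk
  have hev := (hs.eventually_isFrameAt z₀ hz₀).and (he.filter_mono nhdsWithin_le_nhds)
  obtain ⟨R, M', hR, hM', hdet', hMR⟩ := exists_invertible_extension
    (fun z => coordMatrix π fun j => s j z) (meromorphicAt_coordMatrix π (hs.meromorphicAt z₀ hz₀))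
    (hev.mono fun z hz => det_coordMatrix_ne_zero π (fun j => hπ j z) hz.2.isBasisOf.span_eq
      hz.1.isBasisOf)
  classical
  let t : Fin k → ℂ → CN N := fun j z =>
    if z = z₀ then ∑ l, M' z l j • e l z else ∑ i, R z i j • s i z
  have ht : ∀ z ≠ z₀, ∀ᶠ w in 𝓝 z, ∀ j, ∑ i, R w i j • s i w = t j w := fun z hz => by
    filter_upwards [eventually_ne_nhds hz] with w hw j
    simp [t, hw]
  have ht₀ : ∀ᶠ w in 𝓝 z₀, ∀ j, ∑ l, M' w l j • e l w = t j w := by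
    filter_upwards [eventually_nhdsWithin_iff.1 hev] with w hw j
    by_cases h : w = z₀
    · simp [t, h]
    obtain ⟨hsw, hew⟩ := hw h
    have hcoord : ∀ i, s i w = ∑ l, π (s i w) l • e l w := fun i =>
      eq_sum_of_mem_span π (fun j => hπ j w) (hew.isBasisOf.span_eq ▸ hsw.isBasisOf.mem i)
    simp only [t, if_neg h, ← hMR w h, Matrix.mul_apply, Finset.sum_smul]
    rw [Finset.sum_comm]
    refine Finset.sum_congr rfl fun i _ => ?_
    conv_rhs => rw [hcoord i, Finset.smul_sum]
    refine Finset.sum_congr rfl fun l _ => ?_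
    rw [smul_smul, mul_comm]
    rfl
  have hframe₀ : IsFrameAt E t z₀ := (he.self_of_nhds.sum_smul hM' hdet').congr ht₀
  have hframe : ∀ z ≠ z₀, IsFrameAt E s z → IsFrameAt E t z := fun z hz h =>
    (h.sum_smul (hR z hz).1 (hR z hz).2).congr (ht z hz)
  refine ⟨t, ⟨fun z hz j => ?_, fun z hz => ?_⟩, hframe₀, hframe⟩
  · by_cases h : z = z₀
    · exact h ▸ (hframe₀.analyticAt j).meromorphicAt
    · have hmer : MeromorphicAt (fun w => ∑ i, R w i j • s i w) z :=
        MeromorphicAt.fun_sum fun i _ =>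
          ((hR z h).1 i j).meromorphicAt.fun_smul (hs.meromorphicAt z hz i)
      exact hmer.congr (((ht z h).mono fun w hw => hw j).filter_mono nhdsWithin_le_nhds)
  · filter_upwards [hs.eventually_isFrameAt z hz] with w hw
    by_cases h : w = z₀
    · exact h ▸ hframe₀
    · exact hframe w h hw

theorem IsMeromorphicFrameOn.exists_forall_isFrameAt {V : Set ℂ}
    (hE : ∀ z ∈ V, AnalyticSubspaceAt E z) (hk : ∀ z ∈ V, Module.finrank ℂ (E z) = k)
    (S : Finset ℂ) : ∀ {s : Fin k → ℂ → CN N}, IsMeromorphicFrameOn E V s →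
      (∀ z ∈ V, z ∉ S → IsFrameAt E s z) →
      ∃ t : Fin k → ℂ → CN N, ∀ z ∈ V, IsFrameAt E t z := by
  classical
  induction S using Finset.induction_on with
  | empty => exact fun {s} _ h => ⟨s, fun z hz => h z hz (Finset.notMem_empty z)⟩
  | insert a S _ ih =>
    intro s hs h
    by_cases ha : a ∈ V
    · obtain ⟨t, ht, hta, hst⟩ := hs.exists_isFrameAt ha (hE a ha) (hk a ha)
      refine ih ht fun z hz hzS => ?_
      by_cases hza : z = a
      · exact hza ▸ hta
      · exact hst z hza (h z hz (by simp [hza, hzS]))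
    · refine ih hs fun z hz hzS => h z hz ?_
      have hza : z ≠ a := fun h => ha (h ▸ hz)
      simp [hza, hzS]

/-- An analytic family of subspaces on an open set `U` has an analytic basis on a neighbourhood
`V` of every compact subset of `U`. Since `V` is relatively compact in `U`, only finitely many
singular points of a meromorphic frame lie in `V`. The same `V` serves for all families. -/
theorem exists_isAnalyticBasisOn {U Ω : Set ℂ} (hU : IsOpen U) (hΩ : IsCompact Ω)
    (hΩU : Ω ⊆ U) : ∃ V : Set ℂ, IsOpen V ∧ Ω ⊆ V ∧ V ⊆ U ∧
      ∀ {k : ℕ} (E : ℂ → Submodule ℂ (CN N)), (∀ z ∈ U, AnalyticSubspaceAt E z) →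
        (∀ z ∈ U, Module.finrank ℂ (E z) = k) →
        ∃ w : Fin k → ℂ → CN N, IsAnalyticBasisOn E V w := by
  obtain ⟨L, hL, hΩL, hLU⟩ := exists_compact_between hΩ hU hΩU
  refine ⟨interior L, isOpen_interior, hΩL, interior_subset.trans hLU, fun {k} E hE hk => ?_⟩
  obtain ⟨s, hs⟩ := exists_isMeromorphicFrameOn hU hE hk
  have hVU : ∀ z ∈ interior L, z ∈ U := fun z hz => hLU (interior_subset hz)
  have hfin : (L \ {z | IsFrameAt E s z}).Finite := by
    apply hL.finite_sdiff_of_mem_codiscreteWithin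
    rw [mem_codiscreteWithin_iff_forall_mem_nhdsNE]
    intro z hz
    exact mem_of_superset (hs.eventually_isFrameAt z (hLU hz)) Set.subset_union_left
  obtain ⟨t, ht⟩ := IsMeromorphicFrameOn.exists_forall_isFrameAt
    (fun z hz => hE z (hVU z hz)) (fun z hz => hk z (hVU z hz)) hfin.toFinset
    (s := s) ⟨fun z hz => hs.meromorphicAt z (hVU z hz),
      fun z hz => hs.eventually_isFrameAt z (hVU z hz)⟩
    (fun z hz hzS => by
      by_contra h
      exact hzS (hfin.mem_toFinset.2 ⟨interior_subset hz, h⟩))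
  exact ⟨t, fun j z hz => (ht z hz).analyticAt j,
    fun z hz => (ht z hz).isBasisOf.linearIndependent, fun z hz => (ht z hz).isBasisOf.span_eq⟩

/-- The dynamical description on `U₀` fixes the dimension of the subspaces on all of `U`. -/
theorem finrank_eq_of_meets_components {U U₀ : Set ℂ} (hE : ∀ z ∈ U, AnalyticSubspaceAt E z)
    (hU₀ : ∀ z ∈ U, (connectedComponentIn U z ∩ U₀).Nonempty)
    (hk : ∀ z ∈ U₀, Module.finrank ℂ (E z) = k) {z : ℂ} (hz : z ∈ U) :
    Module.finrank ℂ (E z) = k := by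
  obtain ⟨w, hw, hw₀⟩ := hU₀ z hz
  rw [← hk w hw₀]
  exact finrank_eq_of_isPreconnected isPreconnected_connectedComponentIn
    (fun x hx => hE x (connectedComponentIn_subset U z hx)) (mem_connectedComponentIn hz) hw

end TravelingWave

theorem lemma2p2 {N : ℕ} (iM : ℕ) (Ω U : Set ℂ) (hΩ : IsCompact Ω) (hU : IsOpen U) (hΩU : Ω ⊆ U)
    (A : ℝ → ℂ → Matrix (Fin N) (Fin N) ℂ) (Aplus Aminus : ℂ → Matrix (Fin N) (Fin N) ℂ)
    (hA : TravelingWave.IsAsymptoticallyConstant U A Aplus Aminus)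
    (Es Eu : ℂ → Submodule ℂ (CN N))
    (hE : TravelingWave.IsAnalyticStableUnstablePair U A Aplus Aminus iM Es Eu) :
    ∃ V : Set ℂ, IsOpen V ∧ Ω ⊆ V ∧ V ⊆ U ∧
      (∃ wu : Fin iM → ℂ → CN N, TravelingWave.IsAnalyticBasisOn Eu V wu) ∧
      (∃ ws : Fin (N - iM) → ℂ → CN N, TravelingWave.IsAnalyticBasisOn Es V ws) := by
  obtain ⟨U₀, -, -, hU₀, hdyn⟩ := hE.dynamic
  have hu : ∀ z ∈ U, Module.finrank ℂ (Eu z) = iM := fun z hz =>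
    TravelingWave.finrank_eq_of_meets_components hE.analytic_unstable hU₀ (fun w hw => by
      obtain ⟨-, -, -, -, -, E, hinv, -, h0⟩ := hdyn w hw
      exact h0 ▸ hinv.finrank_eq 0) hz
  have hs : ∀ z ∈ U, Module.finrank ℂ (Es z) = N - iM := fun z hz =>
    TravelingWave.finrank_eq_of_meets_components hE.analytic_stable hU₀ (fun w hw => by
      obtain ⟨-, -, -, -, ⟨E, hinv, -, h0⟩, -⟩ := hdyn w hw
      exact h0 ▸ hinv.finrank_eq 0) hz
  obtain ⟨V, hVo, hΩV, hVU, hV⟩ := TravelingWave.exists_isAnalyticBasisOn (N := N) hU hΩ hΩU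
  exact ⟨V, hVo, hΩV, hVU, hV Eu hE.analytic_unstable hu, hV Es hE.analytic_stable hs⟩
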